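/- Let $0<q<1$. Write $(a;q)_m=\prod_{j=0}^{m-1}(1-aq^j)$ and let $$\tilde p_n(x;\alpha,\beta|q)=(-1)^nq^{\binom n2}\frac{(\alpha q;q)_n}{(\alpha\beta q^{n+1};q)_n}\sum_{i=0}^{n}\frac{(q^{-n};q)_i(\alpha\beta q^{n+1};q)_i}{(\alpha q;q)_i}\,\frac{(qx)^i}{(q;q)_i}$$ be the monic little $q$-Jacobi polynomials. Let $w(i)=\frac{(\beta q;q)_i(\alpha q)^i}{(q;q)_i}$, $i=0,1,2,\dots$, be the discrete weight with (positive) mass $w(i)$ at the point $q^i$. A polynomial $Q$ of exact degree $n\ge r$ is called quasi-orthogonal of order $r$ with respect to $w$ on $(0,1)$ if the series $\sum_{i=0}^{\infty}(q^i)^jQ(q^i)w(i)$ converges for $0\le j\le n-r$, has sum $0$ for $0\le j\le n-r-1$, and has non-zero sum for $j=n-r$. Theorem 2.9. Let $k,m\in\mathbb N_0$ and let $\alpha,\beta\in\mathbb R$ with $0<\alpha q<1$ and $0<\beta q<1$. In all three parts $w$ is the weight with the unshifted parameters $\alpha,\beta$. (i) If $\alpha>1$, then for every $n\ge k+1$ the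 polynomial $\tilde p_n(x;\frac{\alpha}{q^k},\beta|q)$ is quasi-orthogonal of order $k$ with respect to $w$ on $(0,1)$, and it has at least $n-k$ real distinct zeros in $(0,1)$. (ii) If $\beta>1$, then for every $n\ge m+1$ the polynomial $\tilde p_n(x;\alpha,\frac{\beta}{q^m}|q)$ is quasi-orthogonal of order $m$ with respect to $w$ on $(0,1)$, and it has at least $n-m$ real distinct zeros in $(0,1)$. (iii) If $\alpha>1$ and $\beta>1$, then for every $n\ge k+m+1$ the polynomial $\tilde p_n(x;\frac{\alpha}{q^k},\frac{\beta}{q^m}|q)$ is quasi-orthogonal of order $k+m$ with respect to $w$ on $(0,1)$, and it has at least $n-(k+m)$ real distinct zeros in $(0,1)$. -/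

import Mathlib

/-- The `q`-shifted factorial `(a; q)_m = ∏_{j=0}^{m-1} (1 - a q^j)`. -/
noncomputable def qPochhammer (a q : ℝ) (m : ℕ) : ℝ :=
  ∏ j ∈ Finset.range m, (1 - a * q ^ j)

/-- The basic hypergeometric series `₂φ₁(a, b; c; q; z)`. -/
noncomputable def qHypergeometric21 (a b c q z : ℝ) : ℝ :=
  ∑' i : ℕ, qPochhammer a q i * qPochhammer b q i / qPochhammer c q i *
    (z ^ i / qPochhammer q q i)

/-- The monic little `q`-Jacobi polynomial
`p̃_n(x; α, β | q) = (-1)^n q^{n(n-1)/2} (αq; q)_n / (αβq^{n+1}; q)_n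
  · ₂φ₁(q^{-n}, αβq^{n+1}; αq; q; qx)`.
The series is written as the sum of its terms of index at most `n`; the others vanish
(see `littleQJacobi_eval`). -/
noncomputable def littleQJacobi (n : ℕ) (α β q : ℝ) : Polynomial ℝ :=
  Polynomial.C ((-1) ^ n * q ^ n.choose 2 *
      (qPochhammer (α * q) q n / qPochhammer (α * β * q ^ (n + 1)) q n)) *
    ∑ i ∈ Finset.range (n + 1),
      Polynomial.C (qPochhammer (q ^ n)⁻¹ q i * qPochhammer (α * β * q ^ (n + 1)) q i /
          qPochhammer (α * q) q i / qPochhammer q q i) *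
        (Polynomial.C q * Polynomial.X) ^ i

theorem qPochhammer_inv_pow_eq_zero {q : ℝ} (hq : q ≠ 0) {n i : ℕ} (h : n < i) :
    qPochhammer (q ^ n)⁻¹ q i = 0 := by
  unfold qPochhammer
  refine Finset.prod_eq_zero (Finset.mem_range.mpr h) ?_
  rw [inv_mul_cancel₀ (pow_ne_zero n hq), sub_self]

/-- The values of `littleQJacobi` are given by the `₂φ₁` series. -/
theorem littleQJacobi_eval {q : ℝ} (hq : q ≠ 0) (n : ℕ) (α β x : ℝ) :
    (littleQJacobi n α β q).eval x =
      (-1) ^ n * q ^ n.choose 2 *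
        (qPochhammer (α * q) q n / qPochhammer (α * β * q ^ (n + 1)) q n) *
      qHypergeometric21 (q ^ n)⁻¹ (α * β * q ^ (n + 1)) (α * q) q (q * x) := by
  unfold qHypergeometric21
  rw [tsum_eq_sum (s := Finset.range (n + 1))]
  · simp only [littleQJacobi, Polynomial.eval_mul, Polynomial.eval_C, Polynomial.eval_finsetSum,
      Polynomial.eval_pow, Polynomial.eval_X]
    congr 1
    refine Finset.sum_congr rfl fun i _ => ?_
    ring
  · intro i hi
    rw [qPochhammer_inv_pow_eq_zero hq (by simpa using hi)]
    simp

/-- The weight `w(i) = (βq; q)_i (αq)^i / (q; q)_i`, placed at the point `q^i`, for which the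
little `q`-Jacobi polynomials are orthogonal. -/
noncomputable def littleQJacobiWeight (α β q : ℝ) (i : ℕ) : ℝ :=
  qPochhammer (β * q) q i * (α * q) ^ i / qPochhammer q q i

/-- `Q` is a polynomial of exact degree `n ≥ k` that is quasi-orthogonal of order `k` on the
interval with end points `a` and `b`, with respect to the discrete weight that has the positive
mass `w i` at the point `x i`, `i = 0, 1, 2, …`: the moments `∑ i, (x i)^m Q(x i) w i` (which
converge) vanish for `m = 0, …, n - k - 1`, and the moment for `m = n - k` does not vanish. -/
structure IsDiscreteQuasiOrthogonal (a b : ℝ) (x w : ℕ → ℝ) (n k : ℕ) (Q : Polynomial ℝ) :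
    Prop where
  mem_Icc : ∀ i, x i ∈ Set.Icc a b
  weight_pos : ∀ i, 0 < w i
  le : k ≤ n
  degree_eq : Q.degree = n
  moment_eq_zero : ∀ m : ℕ, m + k < n → HasSum (fun i => x i ^ m * Q.eval (x i) * w i) 0
  moment_ne_zero : ∃ s : ℝ, s ≠ 0 ∧ HasSum (fun i => x i ^ (n - k) * Q.eval (x i) * w i) s

/-- `Q` has at least `r` distinct real zeros in the open interval `(a, b)`. -/
def HasAtLeastZerosIn (a b : ℝ) (r : ℕ) (Q : Polynomial ℝ) : Prop :=
  ∃ S : Finset ℝ, r ≤ S.card ∧ ∀ y ∈ S, y ∈ Set.Ioo a b ∧ Q.eval y = 0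

/-! The `q`-binomial functional equation makes the moments `μ_s` of the weight satisfy a first-order
recurrence, so `μ_{j+t} / μ_j = (αq^{1+j}; q)_t / (αβq^{2+j}; q)_t`. Write `a = α / q^k`, `b = β /
q^m`. Up to a non-zero factor, the `j`-th moment of the shifted polynomial is a sum over `t ≤ n` in
which `(q^{-n}; q)_t q^t / (q; q)_t` is `(q; q)_n` times the nodal weight of `q^t` among `1, q, …,
q^n`. It is therefore a divided difference of the remaining quotient, viewed as a function of `y =
q^t`.

For `j + k + m < n` that quotient is a polynomial in `y` of degree less than `n`, and the divided
difference vanishes. For `j = n - k - m` it acquires one simple pole off the nodes, and the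
barycentric interpolation formula shows that the result is not zero.

The zeros follow from the sign-change argument: multiplying by a factor for each sign change in `(0,
1)` gives a polynomial of constant sign, which cannot be orthogonal to that product of factors. -/

/-! ### Elementary identities for `q`-shifted factorials. -/

open Polynomial in
/-- The polynomial `y ↦ (c y; q)_N`. -/
noncomputable def qPochhammerPoly (c q : ℝ) (N : ℕ) : ℝ[X] :=
  ∏ j ∈ Finset.range N, (1 - C (c * q ^ j) * X)

theorem eval_qPochhammerPoly (c q y : ℝ) (N : ℕ) :
    (qPochhammerPoly c q N).eval y = qPochhammer (c * y) q N := by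
  simp only [qPochhammerPoly, qPochhammer, Polynomial.eval_prod]
  refine Finset.prod_congr rfl fun j _ => ?_
  simp only [Polynomial.eval_sub, Polynomial.eval_one, Polynomial.eval_mul, Polynomial.eval_C,
    Polynomial.eval_X]
  ring

theorem natDegree_qPochhammerPoly_le (c q : ℝ) (N : ℕ) :
    (qPochhammerPoly c q N).natDegree ≤ N := by
  refine (Polynomial.natDegree_prod_le _ _).trans ?_
  refine (Finset.sum_le_card_nsmul _ _ 1 fun j _ => ?_).trans (by simp)
  compute_degree

theorem qPochhammer_zero (a q : ℝ) : qPochhammer a q 0 = 1 := by simp [qPochhammer]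

theorem qPochhammer_succ (a q : ℝ) (m : ℕ) :
    qPochhammer a q (m + 1) = qPochhammer a q m * (1 - a * q ^ m) := by
  simp [qPochhammer, Finset.prod_range_succ]

theorem qPochhammer_add (a q : ℝ) (m n : ℕ) :
    qPochhammer a q (m + n) = qPochhammer a q m * qPochhammer (a * q ^ m) q n := by
  simp only [qPochhammer, Finset.prod_range_add, pow_add, mul_assoc]

theorem qPochhammer_ne_zero {a q : ℝ} (h : ∀ j : ℕ, a * q ^ j ≠ 1) (m : ℕ) :
    qPochhammer a q m ≠ 0 :=
  Finset.prod_ne_zero_iff.mpr fun j _ => sub_ne_zero.mpr (h j).symm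

theorem mul_pow_lt_one {a q : ℝ} (hq0 : 0 < q) (hq1 : q < 1) (ha0 : 0 < a) (ha1 : a < 1)
    (j : ℕ) : a * q ^ j < 1 :=
  (mul_le_of_le_one_right ha0.le (pow_le_one₀ hq0.le hq1.le)).trans_lt ha1

theorem qPochhammer_pos {a q : ℝ} (hq0 : 0 < q) (hq1 : q < 1) (ha0 : 0 < a) (ha1 : a < 1)
    (m : ℕ) : 0 < qPochhammer a q m :=
  Finset.prod_pos fun j _ => sub_pos.mpr (mul_pow_lt_one hq0 hq1 ha0 ha1 j)

/-- Both sides split `(c; q)_{N+i}`, at `N` and at `i`. -/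
theorem qPochhammer_shift_mul (c q : ℝ) (N i : ℕ) :
    qPochhammer (c * q ^ N) q i * qPochhammer c q N =
      qPochhammer c q i * qPochhammer (c * q ^ i) q N := by
  rw [← qPochhammer_add, mul_comm, ← qPochhammer_add, add_comm]

/-! ### The moments of the weight -/

theorem littleQJacobiWeight_pos {q α β : ℝ} (hq0 : 0 < q) (hq1 : q < 1)
    (hα0 : 0 < α * q) (hβ0 : 0 < β * q) (hβ1 : β * q < 1) (i : ℕ) :
    0 < littleQJacobiWeight α β q i :=
  div_pos (mul_pos (qPochhammer_pos hq0 hq1 hβ0 hβ1 i) (pow_pos hα0 i))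
    (qPochhammer_pos hq0 hq1 hq0 hq1 i)

theorem summable_qBinomial {q b z : ℝ} (hq0 : 0 < q) (hq1 : q < 1) (hb0 : 0 < b) (hb1 : b < 1)
    (hz0 : 0 < z) (hz1 : z < 1) :
    Summable fun i => qPochhammer b q i * z ^ i / qPochhammer q q i := by
  have hpos : ∀ i, 0 < qPochhammer b q i * z ^ i / qPochhammer q q i := fun i =>
    div_pos (mul_pos (qPochhammer_pos hq0 hq1 hb0 hb1 i) (pow_pos hz0 i))
      (qPochhammer_pos hq0 hq1 hq0 hq1 i)
  refine summable_of_ratio_test_tendsto_lt_one hz1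
    (Filter.Eventually.of_forall fun i => (hpos i).ne') ?_
  have hlim : Filter.Tendsto (fun i : ℕ => (1 - b * q ^ i) / (1 - q * q ^ i) * z) Filter.atTop
      (nhds ((1 - b * 0) / (1 - q * 0) * z)) := by
    have hq := tendsto_pow_atTop_nhds_zero_of_lt_one hq0.le hq1
    exact (((hq.const_mul b).const_sub 1).div ((hq.const_mul q).const_sub 1) (by simp)).mul_const z
  simp only [mul_zero, sub_zero, div_one, one_mul] at hlim
  refine hlim.congr fun i => ?_
  rw [Real.norm_of_nonneg (hpos _).le, Real.norm_of_nonneg (hpos _).le, qPochhammer_succ,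
    qPochhammer_succ]
  have h1 := (qPochhammer_pos hq0 hq1 hb0 hb1 i).ne'
  have h2 := (qPochhammer_pos hq0 hq1 hq0 hq1 i).ne'
  have h3 : 1 - q * q ^ i ≠ 0 := (sub_pos.mpr (mul_pow_lt_one hq0 hq1 hq0 hq1 i)).ne'
  rw [pow_succ]
  generalize q * q ^ i = u at *
  field_simp

/-- The functional equation `(1 - z) f(z) = (1 - b z) f(q z)` of
`f(z) = ∑ (b; q)_i z^i / (q; q)_i`. -/
theorem tsum_qBinomial_mul {q b z : ℝ} (hq0 : 0 < q) (hq1 : q < 1) (hb0 : 0 < b) (hb1 : b < 1)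
    (hz0 : 0 < z) (hz1 : z < 1) :
    (1 - z) * ∑' i, qPochhammer b q i * z ^ i / qPochhammer q q i =
      (1 - b * z) * ∑' i, qPochhammer b q i * (z * q) ^ i / qPochhammer q q i := by
  have hzq1 : z * q < 1 := by simpa using mul_pow_lt_one hq0 hq1 hz0 hz1 1
  have hf := summable_qBinomial hq0 hq1 hb0 hb1 hz0 hz1
  have hg := summable_qBinomial hq0 hq1 hb0 hb1 (mul_pos hz0 hq0) hzq1
  -- In `f(z) - f(qz)` the constant term cancels and the factor `1 - q^{i+1}` cancels the last
  -- factor of `(q; q)_{i+1}`, so the shifted series is again a combination of `f(z)` and `f(qz)`.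
  have h1 := (hf.sub hg).tsum_eq_zero_add
  rw [hf.tsum_sub hg] at h1
  have h2 : ∀ i : ℕ, qPochhammer b q (i + 1) * z ^ (i + 1) / qPochhammer q q (i + 1) -
      qPochhammer b q (i + 1) * (z * q) ^ (i + 1) / qPochhammer q q (i + 1) =
      z * (qPochhammer b q i * z ^ i / qPochhammer q q i) -
      b * z * (qPochhammer b q i * (z * q) ^ i / qPochhammer q q i) := by
    intro i
    rw [qPochhammer_succ, qPochhammer_succ]
    have h2 := (qPochhammer_pos hq0 hq1 hq0 hq1 i).ne'
    have h3 : 1 - q * q ^ i ≠ 0 := (sub_pos.mpr (mul_pow_lt_one hq0 hq1 hq0 hq1 i)).ne'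
    rw [mul_pow, mul_pow, pow_succ q, mul_comm (q ^ i) q]
    generalize q * q ^ i = u at *
    field_simp
    ring
  simp only [h2, pow_zero, sub_self, zero_add] at h1
  rw [(hf.mul_left z).tsum_sub (hg.mul_left (b * z)), tsum_mul_left, tsum_mul_left] at h1
  linarith

/-- The `s`-th moment of the little `q`-Jacobi weight. -/
noncomputable def littleQJacobiMoment (α β q : ℝ) (s : ℕ) : ℝ :=
  ∑' i, (q ^ i) ^ s * littleQJacobiWeight α β q i

theorem pow_mul_littleQJacobiWeight (α β q : ℝ) (s i : ℕ) :
    (q ^ i) ^ s * littleQJacobiWeight α β q i =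
      qPochhammer (β * q) q i * (α * q * q ^ s) ^ i / qPochhammer q q i := by
  rw [littleQJacobiWeight, mul_pow (α * q), ← pow_mul, ← pow_mul, mul_comm s i]
  ring

theorem hasSum_littleQJacobiMoment {q α β : ℝ} (hq0 : 0 < q) (hq1 : q < 1)
    (hα0 : 0 < α * q) (hα1 : α * q < 1) (hβ0 : 0 < β * q) (hβ1 : β * q < 1) (s : ℕ) :
    HasSum (fun i => (q ^ i) ^ s * littleQJacobiWeight α β q i)
      (littleQJacobiMoment α β q s) := by
  refine Summable.hasSum ?_
  simp only [pow_mul_littleQJacobiWeight]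
  exact summable_qBinomial hq0 hq1 hβ0 hβ1 (mul_pos hα0 (pow_pos hq0 s))
    (mul_pow_lt_one hq0 hq1 hα0 hα1 s)

theorem littleQJacobiMoment_pos {q α β : ℝ} (hq0 : 0 < q) (hq1 : q < 1)
    (hα0 : 0 < α * q) (hα1 : α * q < 1) (hβ0 : 0 < β * q) (hβ1 : β * q < 1) (s : ℕ) :
    0 < littleQJacobiMoment α β q s := by
  have hw := littleQJacobiWeight_pos hq0 hq1 hα0 hβ0 hβ1
  exact (hasSum_littleQJacobiMoment hq0 hq1 hα0 hα1 hβ0 hβ1 s).summable.tsum_pos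
    (fun i => (mul_pos (pow_pos (pow_pos hq0 i) s) (hw i)).le) 0
    (mul_pos (pow_pos (pow_pos hq0 0) s) (hw 0))

/-- The `s`-th moment is the `q`-binomial series with `b = βq` at `z = αq^{1+s}`, so raising `s`
replaces `z` by `qz`. -/
theorem littleQJacobiMoment_succ {q α β : ℝ} (hq0 : 0 < q) (hq1 : q < 1)
    (hα0 : 0 < α * q) (hα1 : α * q < 1) (hβ0 : 0 < β * q) (hβ1 : β * q < 1) (s : ℕ) :
    (1 - α * β * q ^ 2 * q ^ s) * littleQJacobiMoment α β q (s + 1) =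
      (1 - α * q * q ^ s) * littleQJacobiMoment α β q s := by
  simp only [littleQJacobiMoment, pow_mul_littleQJacobiWeight]
  rw [tsum_qBinomial_mul hq0 hq1 hβ0 hβ1 (mul_pos hα0 (pow_pos hq0 s))
    (mul_pow_lt_one hq0 hq1 hα0 hα1 s), pow_succ q s, ← mul_assoc (α * q)]
  ring

theorem littleQJacobiMoment_add {q α β : ℝ} (hq0 : 0 < q) (hq1 : q < 1)
    (hα0 : 0 < α * q) (hα1 : α * q < 1) (hβ0 : 0 < β * q) (hβ1 : β * q < 1) (s t : ℕ) :
    qPochhammer (α * β * q ^ (2 + s)) q t * littleQJacobiMoment α β q (s + t) =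
      qPochhammer (α * q ^ (1 + s)) q t * littleQJacobiMoment α β q s := by
  induction t with
  | zero => simp [qPochhammer_zero]
  | succ t ih =>
    have h := littleQJacobiMoment_succ hq0 hq1 hα0 hα1 hβ0 hβ1 (s + t)
    rw [qPochhammer_succ, qPochhammer_succ, ← add_assoc]
    linear_combination (1 - α * q ^ (1 + s) * q ^ t) * ih +
      qPochhammer (α * β * q ^ (2 + s)) q t * h

/-! ### Nodal weights of a geometric progression -/

theorem injOn_pow_range {q : ℝ} (hq0 : 0 < q) (hq1 : q < 1) (s : Finset ℕ) :
    Set.InjOn (fun i : ℕ => q ^ i) s :=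
  (pow_right_injective₀ hq0 hq1.ne).injOn

theorem prod_range_pow_sub_pow (q : ℝ) (i : ℕ) :
    ∏ l ∈ Finset.range i, (q ^ i - q ^ l) =
      (∏ l ∈ Finset.range i, -q ^ l) * qPochhammer q q i := by
  rw [qPochhammer, ← Finset.prod_range_reflect (fun j => 1 - q * q ^ j),
    ← Finset.prod_mul_distrib]
  refine Finset.prod_congr rfl fun l hl => ?_
  have h : i = l + (1 + (i - 1 - l)) := by have := Finset.mem_range.mp hl; omega
  nth_rw 1 [h]
  rw [pow_add q l, pow_add q 1]
  ring

theorem qPochhammer_inv_pow_mul {q : ℝ} (hq : q ≠ 0) (i d : ℕ) :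
    qPochhammer (q ^ (i + d))⁻¹ q i * qPochhammer q q d =
      (∏ l ∈ Finset.range i, -q ^ l) * ((q ^ (i + d))⁻¹) ^ i * qPochhammer q q (i + d) := by
  induction i generalizing d with
  | zero => simp [qPochhammer_zero]
  | succ i ih =>
    -- Passing to `d + 1` keeps `i + d`, hence the base `q^{-(i+d)}`, fixed.
    have h := ih (d + 1)
    rw [show i + (d + 1) = i + 1 + d by ring] at h
    rw [qPochhammer_succ q q d] at h
    rw [qPochhammer_succ, Finset.prod_range_succ, pow_succ]
    have h1 : 1 - (q ^ (i + 1 + d))⁻¹ * q ^ i =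
        -q ^ i * (q ^ (i + 1 + d))⁻¹ * (1 - q * q ^ d) := by
      have : (q ^ (i + 1 + d))⁻¹ * q ^ (i + 1 + d) = 1 :=
        inv_mul_cancel₀ (pow_ne_zero _ hq)
      rw [show q ^ (i + 1 + d) = q ^ i * (q * q ^ d) by ring] at this ⊢
      linear_combination -this
    rw [h1]
    linear_combination (-q ^ i * (q ^ (i + 1 + d))⁻¹) * h

theorem prod_range_neg_pow_sq (q : ℝ) (i : ℕ) :
    (∏ l ∈ Finset.range i, -q ^ l) ^ 2 * q ^ i = q ^ (i * i) := by
  induction i with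
  | zero => simp
  | succ i ih =>
    rw [Finset.prod_range_succ]
    calc _ = ((∏ l ∈ Finset.range i, -q ^ l) ^ 2 * q ^ i) * q ^ (2 * i + 1) := by ring
      _ = _ := by rw [ih]; ring

/-- This turns terminating `q`-series into divided differences. The product of `q^i - q^j` over `j ≠
i` splits into the nodes with `j < i` and those with `j > i`, giving `(q; q)_i` and `(q; q)_{n-i}`
up to signs and powers of `q`. -/
theorem qPochhammer_inv_pow_mul_pow_div {q : ℝ} (hq0 : 0 < q) (hq1 : q < 1) {n i : ℕ}
    (hi : i ≤ n) :
    qPochhammer (q ^ n)⁻¹ q i * q ^ i / qPochhammer q q i =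
      qPochhammer q q n *
        Lagrange.nodalWeight (Finset.range (n + 1)) (fun i => q ^ i) i := by
  obtain ⟨d, rfl⟩ := Nat.exists_eq_add_of_le hi
  have hqi := (qPochhammer_pos hq0 hq1 hq0 hq1 i).ne'
  have hqd := (qPochhammer_pos hq0 hq1 hq0 hq1 d).ne'
  have hG : (∏ l ∈ Finset.range i, -q ^ l) ≠ 0 :=
    Finset.prod_ne_zero_iff.mpr fun l _ => neg_ne_zero.mpr (pow_ne_zero _ hq0.ne')
  have hprod : ∏ j ∈ (Finset.range (i + d + 1)).erase i, (q ^ i - q ^ j) =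
      (∏ l ∈ Finset.range i, -q ^ l) * qPochhammer q q i *
        (q ^ (i * d) * qPochhammer q q d) := by
    have h1 : (Finset.range (i + d + 1)).erase i =
        Finset.range i ∪ (Finset.range d).image fun x => i + 1 + x := by
      ext x
      simp only [Finset.mem_erase, Finset.mem_range, Finset.mem_union, Finset.mem_image]
      constructor
      · rintro ⟨h1, h2⟩
        by_cases h : x < i
        · exact Or.inl h
        · exact Or.inr ⟨x - (i + 1), by omega, by omega⟩
      · rintro (h | ⟨a, h, rfl⟩) <;> omega
    rw [h1, Finset.prod_union, Finset.prod_image (by intro a _ b _ h; simpa using h),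
      prod_range_pow_sub_pow]
    · congr 1
      rw [pow_mul, qPochhammer, ← Finset.card_range d, ← Finset.prod_const, Finset.card_range,
        ← Finset.prod_mul_distrib]
      exact Finset.prod_congr rfl fun l _ => by ring
    · rw [Finset.disjoint_left]
      intro a ha hb
      simp only [Finset.mem_range, Finset.mem_image] at ha hb
      omega
  have h1 := qPochhammer_inv_pow_mul hq0.ne' i d
  have h2 := prod_range_neg_pow_sq q i
  have h3 : ((q ^ (i + d))⁻¹) ^ i * (q ^ (i * i) * q ^ (i * d)) = 1 := by
    rw [← pow_add, ← mul_add, mul_comm i, pow_mul, ← mul_pow,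
      inv_mul_cancel₀ (pow_ne_zero _ hq0.ne'), one_pow]
  have hqid : q ^ (i * d) ≠ 0 := pow_ne_zero _ hq0.ne'
  rw [Lagrange.nodalWeight, Finset.prod_inv_distrib, hprod, ← div_eq_mul_inv,
    div_eq_div_iff hqi (by positivity)]
  linear_combination (q ^ i * (∏ l ∈ Finset.range i, -q ^ l) * qPochhammer q q i * q ^ (i * d)) * h1 +
    (qPochhammer q q i * q ^ (i * d) * ((q ^ (i + d))⁻¹) ^ i * qPochhammer q q (i + d)) * h2 +
    (qPochhammer q q (i + d) * qPochhammer q q i) * h3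

/-- The sum is the coefficient of degree `s.card - 1` of the interpolating polynomial, which is `P`
itself. -/
theorem sum_nodalWeight_mul_eval_eq_zero {F ι : Type*} [Field F] [DecidableEq ι] {s : Finset ι}
    {v : ι → F} (hvs : Set.InjOn v s) {P : Polynomial F} (hP : P.natDegree + 1 < s.card) :
    ∑ i ∈ s, Lagrange.nodalWeight s v i * P.eval (v i) = 0 := by
  have hdeg : P.degree < s.card :=
    P.degree_le_natDegree.trans_lt (by exact_mod_cast (by omega : P.natDegree < s.card))
  rw [← Polynomial.coeff_eq_zero_of_natDegree_lt (p := P) (n := s.card - 1) (by omega),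
    Lagrange.coeff_eq_sum hvs hdeg]
  refine Finset.sum_congr rfl fun i _ => ?_
  rw [Lagrange.nodalWeight, Finset.prod_inv_distrib, div_eq_mul_inv, mul_comm]

/-- By the barycentric formula, `P(x)` is the nodal polynomial at `x` times this sum. -/
theorem sum_nodalWeight_mul_inv_sub_mul_eval_ne_zero {F ι : Type*} [Field F] [DecidableEq ι]
    {s : Finset ι} {v : ι → F} (hvs : Set.InjOn v s) {x : F} (hx : ∀ i ∈ s, x ≠ v i)
    {P : Polynomial F} (hP : P.natDegree < s.card) (hPx : P.eval x ≠ 0) :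
    ∑ i ∈ s, Lagrange.nodalWeight s v i * (x - v i)⁻¹ * P.eval (v i) ≠ 0 := by
  have hdeg : P.degree < s.card := P.degree_le_natDegree.trans_lt (by exact_mod_cast hP)
  have h := Lagrange.eval_interpolate_not_at_node (fun i => P.eval (v i)) hx
  rw [← Lagrange.eq_interpolate hvs hdeg] at h
  intro h0
  rw [h0, mul_zero] at h
  exact hPx h

/-! ### The moments of the little `q`-Jacobi polynomials -/

/-- The prefactor making the little `q`-Jacobi polynomial monic. -/
noncomputable def littleQJacobiPrefactor (n : ℕ) (α β q : ℝ) : ℝ :=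
  (-1) ^ n * q ^ n.choose 2 *
    (qPochhammer (α * q) q n / qPochhammer (α * β * q ^ (n + 1)) q n)

/-- The coefficient of `(q x) ^ i` in the `₂φ₁` series of the little `q`-Jacobi polynomial. -/
noncomputable def littleQJacobiCoeff (n : ℕ) (α β q : ℝ) (i : ℕ) : ℝ :=
  qPochhammer (q ^ n)⁻¹ q i * qPochhammer (α * β * q ^ (n + 1)) q i /
    qPochhammer (α * q) q i / qPochhammer q q i

theorem littleQJacobi_eq (n : ℕ) (α β q : ℝ) :
    littleQJacobi n α β q = ∑ i ∈ Finset.range (n + 1), Polynomial.C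
      (littleQJacobiPrefactor n α β q * littleQJacobiCoeff n α β q i * q ^ i) *
        Polynomial.X ^ i := by
  rw [littleQJacobi, Finset.mul_sum]
  refine Finset.sum_congr rfl fun i _ => ?_
  simp only [littleQJacobiPrefactor, littleQJacobiCoeff, mul_pow, Polynomial.C_mul,
    Polynomial.C_pow]
  ring

theorem degree_littleQJacobi {n : ℕ} {a b q : ℝ} (hq0 : 0 < q) (hq1 : q < 1)
    (ha : ∀ l : ℕ, a * q * q ^ l ≠ 1) (hab : ∀ l : ℕ, a * b * q ^ (n + 1) * q ^ l ≠ 1) :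
    (littleQJacobi n a b q).degree = n := by
  have h1 : qPochhammer (q ^ n)⁻¹ q n ≠ 0 := by
    refine Finset.prod_ne_zero_iff.mpr fun j hj => sub_ne_zero.mpr fun h => ?_
    have h2 : q ^ n = q ^ j := by
      rw [eq_comm, inv_mul_eq_one₀ (pow_ne_zero _ hq0.ne')] at h
      exact h
    have := pow_right_injective₀ hq0 hq1.ne h2
    have := Finset.mem_range.mp hj
    omega
  have h2 := qPochhammer_ne_zero ha n
  have h3 := qPochhammer_ne_zero hab n
  have h4 := (qPochhammer_pos hq0 hq1 hq0 hq1 n).ne'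
  have hlead : littleQJacobiPrefactor n a b q * littleQJacobiCoeff n a b q n * q ^ n ≠ 0 := by
    refine mul_ne_zero (mul_ne_zero ?_ ?_) (pow_ne_zero _ hq0.ne')
    · exact mul_ne_zero (mul_ne_zero (by simp) (pow_ne_zero _ hq0.ne')) (div_ne_zero h2 h3)
    · exact div_ne_zero (div_ne_zero (mul_ne_zero h1 h3) h2) h4
  rw [littleQJacobi_eq, Finset.sum_range_succ, Polynomial.degree_add_eq_right_of_degree_lt]
  · exact Polynomial.degree_C_mul_X_pow n hlead
  · rw [Polynomial.degree_C_mul_X_pow n hlead]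
    refine (Polynomial.degree_sum_le _ _).trans_lt ?_
    refine (Finset.sup_lt_iff (WithBot.bot_lt_coe n)).mpr fun i hi => ?_
    exact (Polynomial.degree_C_mul_X_pow_le _ _).trans_lt
      (WithBot.coe_lt_coe.mpr (Nat.cast_lt.mpr (Finset.mem_range.mp hi)))

theorem hasSum_moment_littleQJacobi {q α β : ℝ} (hq0 : 0 < q) (hq1 : q < 1)
    (hα0 : 0 < α * q) (hα1 : α * q < 1) (hβ0 : 0 < β * q) (hβ1 : β * q < 1) (n : ℕ)
    (a b : ℝ) (j : ℕ) :
    HasSum (fun i => (q ^ i) ^ j * (littleQJacobi n a b q).eval (q ^ i) *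
        littleQJacobiWeight α β q i)
      (littleQJacobiPrefactor n a b q * ∑ t ∈ Finset.range (n + 1),
        littleQJacobiCoeff n a b q t * q ^ t * littleQJacobiMoment α β q (j + t)) := by
  have h := hasSum_sum (s := Finset.range (n + 1)) fun t _ =>
    (hasSum_littleQJacobiMoment hq0 hq1 hα0 hα1 hβ0 hβ1 (j + t)).mul_left
      (littleQJacobiPrefactor n a b q * littleQJacobiCoeff n a b q t * q ^ t)
  have he : littleQJacobiPrefactor n a b q * ∑ t ∈ Finset.range (n + 1),
        littleQJacobiCoeff n a b q t * q ^ t * littleQJacobiMoment α β q (j + t) =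
      ∑ t ∈ Finset.range (n + 1), littleQJacobiPrefactor n a b q *
        littleQJacobiCoeff n a b q t * q ^ t * littleQJacobiMoment α β q (j + t) := by
    rw [Finset.mul_sum]
    exact Finset.sum_congr rfl fun t _ => by ring
  rw [he]
  refine h.congr_fun fun i => ?_
  simp only [littleQJacobi_eq, Polynomial.eval_finsetSum, Polynomial.eval_mul, Polynomial.eval_C,
    Polynomial.eval_pow, Polynomial.eval_X]
  rw [Finset.mul_sum, Finset.sum_mul]
  refine Finset.sum_congr rfl fun t _ => ?_
  rw [pow_add]
  ring

theorem sum_littleQJacobiCoeff_mul_moment {q α β : ℝ} (hq0 : 0 < q) (hq1 : q < 1)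
    (hα0 : 0 < α * q) (hα1 : α * q < 1) (hβ0 : 0 < β * q) (hβ1 : β * q < 1) (n : ℕ)
    (a b : ℝ) (j : ℕ) (hαβ : ∀ l : ℕ, α * β * q ^ (2 + j) * q ^ l ≠ 1) :
    ∑ t ∈ Finset.range (n + 1),
        littleQJacobiCoeff n a b q t * q ^ t * littleQJacobiMoment α β q (j + t) =
      littleQJacobiMoment α β q j * qPochhammer q q n * ∑ t ∈ Finset.range (n + 1),
        Lagrange.nodalWeight (Finset.range (n + 1)) (fun i => q ^ i) t *
          ((qPochhammer (a * b * q ^ (n + 1)) q t / qPochhammer (α * β * q ^ (2 + j)) q t) *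
            (qPochhammer (α * q ^ (1 + j)) q t / qPochhammer (a * q) q t)) := by
  rw [Finset.mul_sum]
  refine Finset.sum_congr rfl fun t ht => ?_
  have h1 := qPochhammer_inv_pow_mul_pow_div hq0 hq1 (Nat.lt_succ_iff.mp (Finset.mem_range.mp ht))
  have h2 : littleQJacobiMoment α β q (j + t) =
      qPochhammer (α * q ^ (1 + j)) q t * littleQJacobiMoment α β q j /
        qPochhammer (α * β * q ^ (2 + j)) q t := by
    rw [eq_div_iff (qPochhammer_ne_zero hαβ t), mul_comm,
      littleQJacobiMoment_add hq0 hq1 hα0 hα1 hβ0 hβ1]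
  rw [h2, littleQJacobiCoeff]
  linear_combination (littleQJacobiMoment α β q j *
    ((qPochhammer (a * b * q ^ (n + 1)) q t / qPochhammer (α * β * q ^ (2 + j)) q t) *
            (qPochhammer (α * q ^ (1 + j)) q t / qPochhammer (a * q) q t))) * h1

/-- As a function of `q^t`, such a quotient is a polynomial of degree at most `N`. -/
theorem qPochhammer_shift_div {c q : ℝ} (hc : ∀ l : ℕ, c * q ^ l ≠ 1) (N t : ℕ) :
    qPochhammer (c * q ^ N) q t / qPochhammer c q t =
      (qPochhammer c q N)⁻¹ * (qPochhammerPoly c q N).eval (q ^ t) := by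
  rw [eval_qPochhammerPoly, inv_mul_eq_div, div_eq_div_iff (qPochhammer_ne_zero hc t)
    (qPochhammer_ne_zero hc N), qPochhammer_shift_mul, mul_comm]

/-! ### The vanishing moments and the first non-vanishing one, for shifted parameters. -/

section Shifted

variable {q α β a b : ℝ} {k m n : ℕ}

theorem mul_mul_pow_ne_one (hq0 : 0 < q) (hq1 : q < 1) (hα0 : 0 < α * q) (hα1 : α * q < 1)
    (hβ0 : 0 < β * q) (hβ1 : β * q < 1) (j l : ℕ) : α * β * q ^ (2 + j) * q ^ l ≠ 1 := by
  have h : α * β * q ^ (2 + j) * q ^ l = α * q * (β * q * q ^ (j + l)) := by ring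
  rw [h]
  have h1 := mul_pow_lt_one hq0 hq1 hβ0 hβ1 (j + l)
  have h2 : 0 < β * q * q ^ (j + l) := mul_pos hβ0 (pow_pos hq0 _)
  exact (mul_lt_one_of_nonneg_of_lt_one_left hα0.le hα1 h1.le).ne

theorem sum_littleQJacobiCoeff_mul_moment_eq_zero (hq0 : 0 < q) (hq1 : q < 1)
    (hα0 : 0 < α * q) (hα1 : α * q < 1) (hβ0 : 0 < β * q) (hβ1 : β * q < 1)
    (hα : α = a * q ^ k) (hβ : β = b * q ^ m) (ha : ∀ l : ℕ, a * q * q ^ l ≠ 1)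
    {j : ℕ} (hj : j + (k + m) < n) :
    ∑ t ∈ Finset.range (n + 1),
      littleQJacobiCoeff n a b q t * q ^ t * littleQJacobiMoment α β q (j + t) = 0 := by
  have hαβ := mul_mul_pow_ne_one hq0 hq1 hα0 hα1 hβ0 hβ1 j
  rw [sum_littleQJacobiCoeff_mul_moment hq0 hq1 hα0 hα1 hβ0 hβ1 n a b j hαβ]
  -- With `N = n - 1 - (j + k + m)` the two quotients have degrees at most `N` and `j + k` in `q^t`,
  -- in total `n - 1 - m < n`.
  obtain ⟨N, rfl⟩ := Nat.exists_eq_add_of_lt hj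
  set n := j + (k + m) + N + 1 with hn
  have e1 : a * b * q ^ (n + 1) = α * β * q ^ (2 + j) * q ^ N := by
    rw [hα, hβ, hn]; ring
  have e2 : α * q ^ (1 + j) = a * q * q ^ (j + k) := by rw [hα]; ring
  have h := sum_nodalWeight_mul_eval_eq_zero (injOn_pow_range hq0 hq1 (Finset.range (n + 1)))
    (P := qPochhammerPoly (α * β * q ^ (2 + j)) q N * qPochhammerPoly (a * q) q (j + k)) (by
      refine (Nat.add_le_add_right (Polynomial.natDegree_mul_le.trans (add_le_add
        (natDegree_qPochhammerPoly_le _ _ _) (natDegree_qPochhammerPoly_le _ _ _))) 1).trans_lt ?_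
      rw [Finset.card_range]
      omega)
  refine mul_eq_zero_of_right _ ?_
  rw [← mul_zero ((qPochhammer (α * β * q ^ (2 + j)) q N)⁻¹ * (qPochhammer (a * q) q (j + k))⁻¹),
    ← h, Finset.mul_sum]
  refine Finset.sum_congr rfl fun t _ => ?_
  rw [e1, e2, qPochhammer_shift_div hαβ, qPochhammer_shift_div ha, Polynomial.eval_mul]
  ring

theorem sum_littleQJacobiCoeff_mul_moment_ne_zero (hq0 : 0 < q) (hq1 : q < 1)
    (hα0 : 0 < α * q) (hα1 : α * q < 1) (hβ0 : 0 < β * q) (hβ1 : β * q < 1)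
    (hα : α = a * q ^ k) (hβ : β = b * q ^ m) (ha : ∀ l : ℕ, a * q * q ^ l ≠ 1)
    (hn : k + m + 1 ≤ n) :
    ∑ t ∈ Finset.range (n + 1), littleQJacobiCoeff n a b q t * q ^ t *
      littleQJacobiMoment α β q (n - (k + m) + t) ≠ 0 := by
  -- From here on the moment in question has order `j + 1`. The first quotient is now `(A; q)_t /
  -- (Aq; q)_t = (1 - A) / (1 - A q^t)`, with its pole at `A⁻¹`.
  obtain ⟨j, rfl⟩ := Nat.exists_eq_add_of_le hn
  have hj : k + m + 1 + j - (k + m) = j + 1 := by omega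
  rw [hj]
  set n := k + m + 1 + j with hn
  set A := α * β * q ^ (2 + j) with hA
  have hαβ' := mul_mul_pow_ne_one hq0 hq1 hα0 hα1 hβ0 hβ1 (j + 1)
  have hαβ : ∀ l : ℕ, A * q ^ l ≠ 1 := mul_mul_pow_ne_one hq0 hq1 hα0 hα1 hβ0 hβ1 j
  have hA0 : A ≠ 0 := by
    have : A = (α * q) * (β * q) * q ^ j := by rw [hA]; ring
    rw [this]
    positivity
  rw [sum_littleQJacobiCoeff_mul_moment hq0 hq1 hα0 hα1 hβ0 hβ1 n a b (j + 1) hαβ']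
  have e1 : a * b * q ^ (n + 1) = A := by rw [hA, hα, hβ, hn]; ring
  have e2 : α * q ^ (1 + (j + 1)) = a * q * q ^ (k + j + 1) := by rw [hα]; ring
  have e3 : α * β * q ^ (2 + (j + 1)) = A * q := by rw [hA]; ring
  have hx : ∀ i ∈ Finset.range (n + 1), A⁻¹ ≠ q ^ i := fun i _ h =>
    hαβ i (by rw [← h, mul_inv_cancel₀ hA0])
  have hPx : (qPochhammerPoly (a * q) q (k + j + 1)).eval A⁻¹ ≠ 0 := by
    rw [eval_qPochhammerPoly]
    -- A root at `A⁻¹` would give `a q^{1+l} = A = aβ q^{k+j+2}` with `l ≤ k + j`, hence `βq · q^d =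
    -- 1` for `d = k + j - l`, against `βq < 1`.
    refine Finset.prod_ne_zero_iff.mpr fun l hl => sub_ne_zero.mpr fun h => ?_
    have hl := Finset.mem_range.mp hl
    obtain ⟨d, hd⟩ := Nat.exists_eq_add_of_lt hl
    have h1 : a * q * q ^ l = A := by
      field_simp at h
      linear_combination -h
    have ha0 : a ≠ 0 := by
      rintro rfl
      simp [hα] at hα0
    have h2 : a * q * q ^ l = a * q * q ^ l * (β * q * q ^ d) := by
      calc a * q * q ^ l = A := h1
        _ = a * q * β * q ^ (k + j + 1) := by rw [hA, hα]; ring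
        _ = _ := by rw [hd]; ring
    have h3 : a * q * q ^ l ≠ 0 := by positivity
    exact (mul_pow_lt_one hq0 hq1 hβ0 hβ1 d).ne ((mul_eq_left₀ h3).mp h2.symm)
  have h := sum_nodalWeight_mul_inv_sub_mul_eval_ne_zero
    (injOn_pow_range hq0 hq1 (Finset.range (n + 1))) hx
    (P := qPochhammerPoly (a * q) q (k + j + 1)) (by
      refine (natDegree_qPochhammerPoly_le _ _ _).trans_lt ?_
      rw [Finset.card_range]
      omega) hPx
  have hA1 : 1 - A ≠ 0 := sub_ne_zero.mpr (by simpa using (hαβ 0).symm)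
  refine mul_ne_zero (mul_ne_zero
    (littleQJacobiMoment_pos hq0 hq1 hα0 hα1 hβ0 hβ1 _).ne'
    (qPochhammer_pos hq0 hq1 hq0 hq1 n).ne') ?_
  have hconst : (1 - A) * A⁻¹ * (qPochhammer (a * q) q (k + j + 1))⁻¹ ≠ 0 :=
    mul_ne_zero (mul_ne_zero hA1 (inv_ne_zero hA0)) (inv_ne_zero (qPochhammer_ne_zero ha _))
  convert mul_ne_zero hconst h using 1
  rw [Finset.mul_sum]
  refine Finset.sum_congr rfl fun t _ => ?_
  have h1 : qPochhammer A q t / qPochhammer (A * q) q t = (1 - A) * A⁻¹ * (A⁻¹ - q ^ t)⁻¹ := by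
    have hs := qPochhammer_shift_mul A q 1 t
    have h2 : qPochhammer (A * q) q t ≠ 0 := qPochhammer_ne_zero (fun l => by
      have := hαβ (l + 1)
      rwa [pow_succ', ← mul_assoc] at this) t
    have h3 : 1 - A * q ^ t ≠ 0 := sub_ne_zero.mpr (hαβ t).symm
    have h4 : (A⁻¹ - q ^ t)⁻¹ = A * (1 - A * q ^ t)⁻¹ := by
      have h5 : A⁻¹ - q ^ t = (1 - A * q ^ t) * A⁻¹ := by
        rw [sub_mul, one_mul, mul_right_comm, mul_inv_cancel₀ hA0, one_mul]
      rw [h5, mul_inv, inv_inv, mul_comm]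
    simp only [pow_one, qPochhammer, Finset.prod_range_one, pow_zero, mul_one] at hs
    rw [h4, ← mul_assoc, mul_assoc (1 - A), inv_mul_cancel₀ hA0, mul_one, ← div_eq_mul_inv,
      div_eq_div_iff h2 h3]
    simp only [qPochhammer]
    linear_combination -hs
  rw [e1, e2, e3, qPochhammer_shift_div ha, h1]
  ring

end Shifted

/-! ### Zeros from vanishing moments -/

open Polynomial in
/-- Some of the zeros of `Q` in `(0, 1)` are the places where `Q` changes sign in that interval. -/
theorem exists_finset_roots_mul_prod_sign (d : ℕ) (Q : ℝ[X]) (hd : Q.natDegree ≤ d)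
    (hQ : Q ≠ 0) :
    ∃ S : Finset ℝ, (∀ y ∈ S, y ∈ Set.Ioo (0 : ℝ) 1 ∧ Q.eval y = 0) ∧
      ((∀ x ∈ Set.Ioo (0 : ℝ) 1, 0 ≤ (Q * ∏ s ∈ S, (X - C s)).eval x) ∨
        ∀ x ∈ Set.Ioo (0 : ℝ) 1, (Q * ∏ s ∈ S, (X - C s)).eval x ≤ 0) := by
  induction d generalizing Q with
  | zero =>
    refine ⟨∅, by simp, ?_⟩
    rw [eq_C_of_natDegree_le_zero hd]
    simp only [Finset.prod_empty, mul_one, eval_C]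
    exact (le_total 0 (Q.coeff 0)).imp (fun h _ _ => h) fun h _ _ => h
  | succ d ih =>
    by_cases hroot : ∃ s ∈ Set.Ioo (0 : ℝ) 1, Q.eval s = 0
    · obtain ⟨s, hs, hs0⟩ := hroot
      obtain ⟨R, rfl⟩ := dvd_iff_isRoot.mpr hs0
      have hR : R ≠ 0 := right_ne_zero_of_mul hQ
      rw [natDegree_mul (X_sub_C_ne_zero s) hR, natDegree_X_sub_C] at hd
      obtain ⟨S, hS, hsign⟩ := ih R (by omega) hR
      -- A sign change of `R` at `s` is cancelled by the factor `X - s`, so `s` leaves `S`;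
      -- otherwise `s` joins `S`, and the product gains the square `(x - s)^2`.
      by_cases hsS : s ∈ S
      · refine ⟨S.erase s, fun y hy => ?_, ?_⟩
        · have := hS y (Finset.mem_of_mem_erase hy)
          exact ⟨this.1, by rw [eval_mul, this.2, mul_zero]⟩
        · rwa [mul_comm (X - C s), mul_assoc, Finset.mul_prod_erase S (fun s => X - C s) hsS]
      · refine ⟨insert s S, fun y hy => ?_, ?_⟩
        · rcases Finset.mem_insert.mp hy with rfl | hy
          · exact ⟨hs, hs0⟩
          · exact ⟨(hS y hy).1, by rw [eval_mul, (hS y hy).2, mul_zero]⟩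
        · have he : ∀ x, ((X - C s) * R * ∏ r ∈ insert s S, (X - C r)).eval x =
              (x - s) ^ 2 * (R * ∏ r ∈ S, (X - C r)).eval x := by
            intro x
            rw [Finset.prod_insert hsS]
            simp only [eval_mul, eval_sub, eval_X, eval_C]
            ring
          simp only [he]
          exact hsign.imp (fun h x hx => mul_nonneg (sq_nonneg _) (h x hx))
            fun h x hx => mul_nonpos_of_nonneg_of_nonpos (sq_nonneg _) (h x hx)
    · push Not at hroot
      refine ⟨∅, by simp, ?_⟩
      simp only [Finset.prod_empty, mul_one]
      by_contra! h
      obtain ⟨⟨x, hx, hx0⟩, y, hy, hy0⟩ := h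
      have hsub : Set.uIcc x y ⊆ Set.Ioo (0 : ℝ) 1 := Set.ordConnected_Ioo.uIcc_subset hx hy
      obtain ⟨z, hz, hz0⟩ := intermediate_value_uIcc (Q.continuous.continuousOn (s := Set.uIcc x y))
        (Set.mem_uIcc.mpr (Or.inl ⟨hx0.le, hy0.le⟩) : (0 : ℝ) ∈ _)
      exact hroot z (hsub hz) hz0

open Polynomial in
/-- If a nonzero polynomial is orthogonal to all powers below `r` for a positive discrete weight
with infinitely many nodes in `[0, 1]`, then it has at least `r` zeros in `(0, 1)`. -/
theorem hasAtLeastZerosIn_of_moments_eq_zero {x w : ℕ → ℝ} {Q : ℝ[X]} {r : ℕ} (hQ : Q ≠ 0)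
    (hx : ∀ i, x i ∈ Set.Icc (0 : ℝ) 1) (hinj : Function.Injective x) (hw : ∀ i, 0 < w i)
    (hmom : ∀ j < r, HasSum (fun i => x i ^ j * Q.eval (x i) * w i) 0) :
    HasAtLeastZerosIn 0 1 r Q := by
  obtain ⟨S, hS, hsign⟩ := exists_finset_roots_mul_prod_sign _ Q le_rfl hQ
  refine ⟨S, ?_, hS⟩
  by_contra! hcard
  set T : ℝ[X] := ∏ s ∈ S, (X - C s) with hT
  have hT0 : T ≠ 0 := Finset.prod_ne_zero_iff.mpr fun s _ => X_sub_C_ne_zero s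
  have hTdeg : T.natDegree < r := by
    rw [hT, natDegree_prod_of_monic _ _ fun s _ => monic_X_sub_C s]
    simpa using hcard
  have hsum : HasSum (fun i => (Q * T).eval (x i) * w i) 0 := by
    have h := hasSum_sum (s := Finset.range r) fun j hj =>
      (hmom j (Finset.mem_range.mp hj)).mul_left (T.coeff j)
    simp only [mul_zero, Finset.sum_const_zero] at h
    refine h.congr_fun fun i => ?_
    rw [eval_mul, T.eval_eq_sum_range' hTdeg, Finset.mul_sum, Finset.sum_mul]
    exact Finset.sum_congr rfl fun j _ => by ring
  -- Nodes may be endpoints (as `q^0 = 1` is), so the sign is extended to `[0, 1]` by continuity.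
  have hcl : ∀ y ∈ Set.Icc (0 : ℝ) 1, y ∈ closure (Set.Ioo (0 : ℝ) 1) := fun y hy => by
    rwa [closure_Ioo zero_ne_one]
  have hzero : ∀ i, (Q * T).eval (x i) = 0 := by
    rcases hsign with h | h
    · have hnn : ∀ i, 0 ≤ (Q * T).eval (x i) := fun i =>
        closure_minimal h (isClosed_le continuous_const (Q * T).continuous) (hcl _ (hx i))
      have := (hasSum_zero_iff_of_nonneg fun i => mul_nonneg (hnn i) (hw i).le).mp hsum
      exact fun i => (mul_eq_zero.mp (congrFun this i)).resolve_right (hw i).ne'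
    · have hnp : ∀ i, (Q * T).eval (x i) ≤ 0 := fun i =>
        closure_minimal h (isClosed_le (Q * T).continuous continuous_const) (hcl _ (hx i))
      have hneg : HasSum (fun i => -((Q * T).eval (x i) * w i)) 0 := by simpa using hsum.neg
      have := (hasSum_zero_iff_of_nonneg fun i => neg_nonneg.mpr
        (mul_nonpos_of_nonpos_of_nonneg (hnp i) (hw i).le)).mp hneg
      exact fun i => (mul_eq_zero.mp (neg_eq_zero.mp (congrFun this i))).resolve_right (hw i).ne'
  exact mul_ne_zero hQ hT0 (eq_zero_of_infinite_isRoot _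
    ((Set.infinite_range_of_injective hinj).mono (Set.range_subset_iff.mpr hzero)))

/-! ### Quasi-orthogonality -/

theorem quasiOrthogonal_littleQJacobi {q α β : ℝ} {k m n : ℕ} (hq0 : 0 < q) (hq1 : q < 1)
    (hα0 : 0 < α * q) (hα1 : α * q < 1) (hβ0 : 0 < β * q) (hβ1 : β * q < 1)
    (ha : ∀ l : ℕ, α / q ^ k * q * q ^ l ≠ 1) (hn : k + m + 1 ≤ n) :
    IsDiscreteQuasiOrthogonal 0 1 (fun i => q ^ i) (littleQJacobiWeight α β q) n (k + m)
        (littleQJacobi n (α / q ^ k) (β / q ^ m) q) ∧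
      HasAtLeastZerosIn 0 1 (n - (k + m)) (littleQJacobi n (α / q ^ k) (β / q ^ m) q) := by
  have hα : α = α / q ^ k * q ^ k := (div_mul_cancel₀ _ (pow_ne_zero _ hq0.ne')).symm
  have hβ : β = β / q ^ m * q ^ m := (div_mul_cancel₀ _ (pow_ne_zero _ hq0.ne')).symm
  set a := α / q ^ k
  set b := β / q ^ m
  -- Since `n ≥ k + m + 1`, the factor `q^{n+1}` absorbs both shifts and leaves at least
  -- `αβq^2`-type decay.
  have hab : ∀ l : ℕ, a * b * q ^ (n + 1) * q ^ l ≠ 1 := by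
    intro l
    obtain ⟨j, rfl⟩ := Nat.exists_eq_add_of_le hn
    have h := mul_mul_pow_ne_one hq0 hq1 hα0 hα1 hβ0 hβ1 j l
    rw [hα, hβ] at h
    convert h using 1
    ring
  have hx : ∀ i : ℕ, q ^ i ∈ Set.Icc (0 : ℝ) 1 := fun i =>
    ⟨(pow_pos hq0 i).le, pow_le_one₀ hq0.le hq1.le⟩
  have hw := littleQJacobiWeight_pos hq0 hq1 hα0 hβ0 hβ1
  have hdeg := degree_littleQJacobi hq0 hq1 ha hab
  have hmom : ∀ j : ℕ, j + (k + m) < n → HasSum (fun i => (q ^ i) ^ j *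
      (littleQJacobi n a b q).eval (q ^ i) * littleQJacobiWeight α β q i) 0 := by
    intro j hj
    have h := hasSum_moment_littleQJacobi hq0 hq1 hα0 hα1 hβ0 hβ1 n a b j
    rwa [sum_littleQJacobiCoeff_mul_moment_eq_zero hq0 hq1 hα0 hα1 hβ0 hβ1 hα hβ ha hj,
      mul_zero] at h
  have hpre : littleQJacobiPrefactor n a b q ≠ 0 :=
    mul_ne_zero (mul_ne_zero (by simp) (pow_ne_zero _ hq0.ne'))
      (div_ne_zero (qPochhammer_ne_zero ha n) (qPochhammer_ne_zero hab n))
  refine ⟨⟨hx, hw, by omega, hdeg, hmom, _, mul_ne_zero hpre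
    (sum_littleQJacobiCoeff_mul_moment_ne_zero hq0 hq1 hα0 hα1 hβ0 hβ1 hα hβ ha hn),
    hasSum_moment_littleQJacobi hq0 hq1 hα0 hα1 hβ0 hβ1 n a b _⟩, ?_⟩
  refine hasAtLeastZerosIn_of_moments_eq_zero ?_ hx (pow_right_injective₀ hq0 hq1.ne) hw
    fun j hj => hmom j (by omega)
  intro h
  rw [h, Polynomial.degree_zero] at hdeg
  exact WithBot.bot_ne_coe hdeg

/-- Because `1 < α < q⁻¹`, the number `αq^{l+1}` lies strictly between the consecutive powers
`q^{l+1}` and `q^l`, so it is not `q^k`. -/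
theorem div_pow_mul_pow_ne_one {q α : ℝ} (hq0 : 0 < q) (hq1 : q < 1) (hα1 : α * q < 1)
    (hα : 1 < α) (k l : ℕ) : α / q ^ k * q * q ^ l ≠ 1 := by
  intro h
  have h1 : α * q * q ^ l = q ^ k := by
    have := pow_ne_zero k hq0.ne'
    field_simp at h
    linear_combination h
  have hql := pow_pos hq0 l
  have hk : k < l + 1 := by
    rw [← pow_lt_pow_iff_right_of_lt_one₀ hq0 hq1, ← h1]
    calc q ^ (l + 1) = 1 * (q * q ^ l) := by ring
      _ < α * (q * q ^ l) := mul_lt_mul_of_pos_right hα (by positivity)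
      _ = _ := by ring
  have hl : l < k := by
    rw [← pow_lt_pow_iff_right_of_lt_one₀ hq0 hq1, ← h1]
    exact mul_lt_of_lt_one_left hql hα1
  omega

theorem theorem2p9 (q α β : ℝ) (hq0 : 0 < q) (hq1 : q < 1)
    (hα0 : 0 < α * q) (hα1 : α * q < 1) (hβ0 : 0 < β * q) (hβ1 : β * q < 1) :
    (1 < α → ∀ k n : ℕ, k + 1 ≤ n →
      IsDiscreteQuasiOrthogonal 0 1 (fun i => q ^ i) (littleQJacobiWeight α β q) n k
          (littleQJacobi n (α / q ^ k) β q) ∧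
        HasAtLeastZerosIn 0 1 (n - k) (littleQJacobi n (α / q ^ k) β q)) ∧
    (1 < β → ∀ m n : ℕ, m + 1 ≤ n →
      IsDiscreteQuasiOrthogonal 0 1 (fun i => q ^ i) (littleQJacobiWeight α β q) n m
          (littleQJacobi n α (β / q ^ m) q) ∧
        HasAtLeastZerosIn 0 1 (n - m) (littleQJacobi n α (β / q ^ m) q)) ∧
    (1 < α → 1 < β → ∀ k m n : ℕ, k + m + 1 ≤ n →
      IsDiscreteQuasiOrthogonal 0 1 (fun i => q ^ i) (littleQJacobiWeight α β q) n (k + m)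
          (littleQJacobi n (α / q ^ k) (β / q ^ m) q) ∧
        HasAtLeastZerosIn 0 1 (n - (k + m)) (littleQJacobi n (α / q ^ k) (β / q ^ m) q)) := by
  refine ⟨fun hα k n hn => ?_, fun _ m n hn => ?_, fun hα _ k m n hn => ?_⟩
  · simpa using quasiOrthogonal_littleQJacobi (m := 0) hq0 hq1 hα0 hα1 hβ0 hβ1
      (div_pow_mul_pow_ne_one hq0 hq1 hα1 hα k) hn
  · simpa using quasiOrthogonal_littleQJacobi (k := 0) (m := m) (n := n) hq0 hq1 hα0 hα1 hβ0 hβ1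
      (fun l => by simpa using (mul_pow_lt_one hq0 hq1 hα0 hα1 l).ne) (by omega)
  · exact quasiOrthogonal_littleQJacobi hq0 hq1 hα0 hα1 hβ0 hβ1
      (div_pow_mul_pow_ne_one hq0 hq1 hα1 hα k) hn
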